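/- Let $H=(V,E)$ be a $3$-uniform hypergraph, i.e. $V$ is a set (finite or infinite) and $E$ is a set of $3$-element subsets of $V$. A linear cycle of length $k\ge 3$ in $H$ is an alternating sequence $v_1,h_1,v_2,h_2,\dots,v_k,h_k$ of distinct vertices $v_i\in V$ and distinct hyperedges $h_i\in E$ such that $h_i\cap h_{i+1}=\{v_{i+1}\}$ for $1\le i\le k-1$, $h_1\cap h_k=\{v_1\}$, and $h_i\cap h_j=\emptyset$ whenever $1<|j-i|<k-1$. Suppose that $H$ contains no linear cycle of any length $k\ge 3$, and that $H$ does not contain the complete $3$-uniform hypergraph $K_5^3$ on five vertices as a subhypergraph, i.e. there is no set $S\subseteq V$ with $|S|=5$ all of whose $3$-element subsets are hyperedges of $H$. Then $H$ is $2$-colorable: there is a coloring of $V$ with two colors such that no hyperedge of $H$ is monochromatic. -/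

import Mathlib

namespace Hypergraph

/-- `H` is `r`-uniform: every hyperedge is an `r`-element set of vertices. -/
def IsUniform {α : Type*} (H : Hypergraph α) (r : ℕ) : Prop :=
  ∀ e ∈ H.edgeSet, e.encard = r

/-- `G` is a subhypergraph of `H`. -/
def IsSubhypergraph {α : Type*} (G H : Hypergraph α) : Prop :=
  G.vertexSet ⊆ H.vertexSet ∧ G.edgeSet ⊆ H.edgeSet

/-- The complete `r`-uniform hypergraph with vertex set `s`. -/
def completeUniformOn {α : Type*} (s : Set α) (r : ℕ) : Hypergraph α where
  vertexSet := s
  edgeSet := {e | e ⊆ s ∧ e.encard = r}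
  subset_vertexSet_of_mem_edgeSet' := fun _ he => he.1

/-- `H` contains the complete `r`-uniform hypergraph on `n` vertices as a subhypergraph. -/
def ContainsCompleteUniform {α : Type*} (H : Hypergraph α) (n r : ℕ) : Prop :=
  ∃ s : Set α, s.encard = n ∧ (completeUniformOn s r).IsSubhypergraph H

/-- The alternating sequence `v 0, h 0, v 1, h 1, …, v (k - 1), h (k - 1)` of distinct vertices and
distinct hyperedges is a linear cycle of length `k ≥ 3` in `H` (indices start at `0`). -/
structure IsLinearCycle {α : Type*} (H : Hypergraph α) (k : ℕ)
    (v : Fin k → α) (h : Fin k → Set α) : Prop where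
  three_le : 3 ≤ k
  vertex_mem : ∀ i, v i ∈ H.vertexSet
  edge_mem : ∀ i, h i ∈ H.edgeSet
  vertex_injective : Function.Injective v
  edge_injective : Function.Injective h
  /-- Consecutive hyperedges meet exactly in the vertex between them. -/
  inter_succ : ∀ i j : Fin k, (i : ℕ) + 1 = j → h i ∩ h j = {v j}
  /-- The first and the last hyperedge meet exactly in the first vertex. -/
  inter_first_last : ∀ i j : Fin k, (i : ℕ) = 0 → (j : ℕ) + 1 = k → h i ∩ h j = {v i}
  /-- Hyperedges with `1 < j - i < k - 1` are disjoint. -/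
  inter_far : ∀ i j : Fin k, (i : ℕ) + 1 < j → (j : ℕ) + 1 < i + k → h i ∩ h j = ∅

/-- `H` has no linear cycle (of any length). -/
def LinearCycleFree {α : Type*} (H : Hypergraph α) : Prop :=
  ∀ (k : ℕ) (v : Fin k → α) (h : Fin k → Set α), ¬ H.IsLinearCycle k v h

/-- The hyperedge `e` is monochromatic under the vertex coloring `c`. -/
def IsMonochromatic {α κ : Type*} (H : Hypergraph α) (c : H.vertexSet → κ) (e : Set α) : Prop :=
  ∃ a : κ, ∀ x : H.vertexSet, (x : α) ∈ e → c x = a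

/-- `H` is `k`-colorable: its vertices can be colored with `k` colors so that no hyperedge is
monochromatic. -/
def IsColorable {α : Type*} (H : Hypergraph α) (k : ℕ) : Prop :=
  ∃ c : H.vertexSet → Fin k, ∀ e ∈ H.edgeSet, ¬ H.IsMonochromatic c e

end Hypergraph

/-! The coloring is grown from pairs of disjoint classes `R`, `S`. With `V = R ∪ S`, the invariant
`IsPartialColoring` asks that every edge with at least two vertices in `V` already be bichromatic on
`V`, and that any two vertices at which an edge meets `V` in a single point be joined by a linear
path inside `V`. Zorn's lemma gives a maximal pair. If no edge meets it in exactly one point, any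
further vertex can be added freely, so maximality forces `V` to be everything.

Suppose instead that an edge `h` meets `V` exactly in `q`. Among the edges meeting `V` at most in
`q`, a block `B` through `q` and another point of `h` is found (`exists_isBlock`): a set of three to
five points with its own coloring, internally connected by linear paths, and such that two points
other than `q` of equal color are separated by a triple through `q`. Glue `B` to `V` at `q`, making
the colors agree there. An edge through some `r ≠ q` of `V` and a new point `b` of `B`, with third
vertex `o` outside `V`, would close a path from `r` through `q` to `b` into a linear cycle. The only
escape is that `o` lies in `B` with the color opposite to `b`, and then the edge is bichromatic.

Blocks come from a local analysis. If some pair of a triple lies in no other triple, the triple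
itself is a block. Otherwise the absence of linear triangles makes two of the extending points
coincide, and a block on four or five points arises. The exclusion of the complete system on five
points is needed only when five points are closed under taking third points: a missing triple and
the complementary pair are then the color classes. -/

namespace Hypergraph

/-! ### Local systems of triples and rooted blocks -/

/-- A symmetric system of triples without linear triangles and without a complete system on five
points. -/
structure IsLocalSystem {α : Type*} (T : α → α → α → Prop) : Prop where
  swap : ∀ {a b c}, T a b c → T b a c
  rot : ∀ {a b c}, T a b c → T b c a
  ne : ∀ {a b c}, T a b c → a ≠ b
  no_triangle : ∀ {a b c x y z}, T a b x → T b c y → T c a z →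
    x ≠ y → y ≠ z → x ≠ z → x ≠ c → y ≠ a → z ≠ b → False
  no_complete : ∀ {a b c d e}, T a b c → T a b d → T a b e → T a c d → T a c e → T a d e →
    T b c d → T b c e → T b d e → T c d e → False

/-- The colouring `χ` of `B` makes every triple with at least two points in `B` bichromatic
on `B`. -/
def ColorsBlock {α : Type*} (T : α → α → α → Prop) (B : Set α) (χ : α → Prop) : Prop :=
  ∀ a b c, T a b c → a ∈ B → b ∈ B → (χ a ↔ χ b) → c ∈ B ∧ ¬ (χ c ↔ χ a)

/-- `a` and `b` are joined inside `B` by a linear path with at most two triples. -/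
def JoinedIn {α : Type*} (T : α → α → α → Prop) (B : Set α) (a b : α) : Prop :=
  (∃ c ∈ B, T a b c) ∨
    ∃ m ∈ B, ∃ c ∈ B, ∃ d ∈ B, T a c m ∧ T m d b ∧ a ≠ d ∧ c ≠ d ∧ c ≠ b

/-- Any two points of `B` are joined inside `B` by a linear path with at most two triples. -/
def BlockConnected {α : Type*} (T : α → α → α → Prop) (B : Set α) : Prop :=
  ∀ a ∈ B, ∀ b ∈ B, a ≠ b → JoinedIn T B a b

/-- Any two points of `B` other than `q` are separated by a triple through `q`. -/
def SeparatesFrom {α : Type*} (T : α → α → α → Prop) (q : α) (B : Set α) (χ : α → Prop) : Prop :=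
  ∀ b ∈ B, ∀ c ∈ B, b ≠ c → b ≠ q → c ≠ q → (χ b ↔ χ c) →
    ∃ x, (T q b x ∧ x ≠ c) ∨ (T q c x ∧ x ≠ b)

/-- `B` is a block rooted at `q`. -/
structure IsBlock {α : Type*} (T : α → α → α → Prop) (q : α) (B : Set α) (χ : α → Prop) :
    Prop where
  colors : ColorsBlock T B χ
  connected : BlockConnected T B
  separates : SeparatesFrom T q B χ

namespace IsLocalSystem

variable {α : Type*} {T : α → α → α → Prop}

theorem ne' (hT : IsLocalSystem T) {a b c} (h : T a b c) : a ≠ b ∧ a ≠ c ∧ b ≠ c :=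
  ⟨hT.ne h, fun e => hT.ne (hT.rot (hT.rot h)) e.symm, hT.ne (hT.rot h)⟩

theorem joinedIn_symm (hT : IsLocalSystem T) {B : Set α} {a b : α} (h : JoinedIn T B a b) :
    JoinedIn T B b a := by
  rcases h with ⟨c, hc, h⟩ | ⟨m, hm, c, hc, d, hd, h₁, h₂, h₃, h₄, h₅⟩
  · exact Or.inl ⟨c, hc, hT.swap h⟩
  · exact Or.inr ⟨m, hm, d, hd, c, hc, by have := @hT.swap; have := @hT.rot; grind,
      by have := @hT.swap; have := @hT.rot; grind, h₅.symm, h₄.symm, h₃.symm⟩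

/-- A block with colour classes `{p₁, p₂}` and `{r₁, r₂, r₃}`. -/
theorem colorsBlock_two_three (hT : IsLocalSystem T) {Q : Set α} {p₁ p₂ r₁ r₂ r₃ : α}
    (hQ : ∀ x, x ∈ Q ↔ x = p₁ ∨ x = p₂ ∨ x = r₁ ∨ x = r₂ ∨ x = r₃)
    (hp₁ : p₁ ≠ r₁ ∧ p₁ ≠ r₂ ∧ p₁ ≠ r₃) (hp₂ : p₂ ≠ r₁ ∧ p₂ ≠ r₂ ∧ p₂ ≠ r₃)
    (hr : ¬ T r₁ r₂ r₃)
    (hp : ∀ t, T p₁ p₂ t → t ∈ Q) (h₁₂ : ∀ t, T r₁ r₂ t → t ∈ Q)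
    (h₁₃ : ∀ t, T r₁ r₃ t → t ∈ Q) (h₂₃ : ∀ t, T r₂ r₃ t → t ∈ Q) :
    ColorsBlock T Q (fun x => x = p₁ ∨ x = p₂) := by
  intro a b c habc ha hb hab
  have hne := hT.ne' habc
  have s1 := @hT.swap
  have s2 := @hT.rot
  rw [hQ] at ha hb
  have hc : c ∈ Q := by
    rcases ha with rfl | rfl | rfl | rfl | rfl <;> rcases hb with rfl | rfl | rfl | rfl | rfl <;>
      grind
  refine ⟨hc, ?_⟩
  rw [hQ] at hc
  grind

end IsLocalSystem
-- Blocks on four and five points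
/-- The triple `a b c` lies in a common block rooted at each of its points. -/
def HasBlock {α : Type*} (T : α → α → α → Prop) (a b c : α) : Prop :=
  ∃ (B : Set α) (χ : α → Prop), a ∈ B ∧ b ∈ B ∧ c ∈ B ∧
    ∀ q, q = a ∨ q = b ∨ q = c → IsBlock T q B χ

namespace IsLocalSystem

variable {α : Type*} {T : α → α → α → Prop}

/-- On a closed five-point set a split into a pair and three points can fail only if the three
points form a triple. If all ten splits fail, the system on the five points is complete. -/
theorem exists_colorsBlock_of_closed (hT : IsLocalSystem T) {Q : Set α} {a b c d e : α}
    (hQ : ∀ x, x ∈ Q ↔ x = a ∨ x = b ∨ x = c ∨ x = d ∨ x = e)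
    (hd : a ≠ b ∧ a ≠ c ∧ a ≠ d ∧ a ≠ e ∧ b ≠ c ∧ b ≠ d ∧ b ≠ e ∧ c ≠ d ∧ c ≠ e ∧ d ≠ e)
    (hcl : ∀ x ∈ Q, ∀ y ∈ Q, ∀ t, T x y t → t ∈ Q) :
    ∃ χ, ColorsBlock T Q χ := by
  by_contra hno
  have key : ∀ p₁ p₂ r₁ r₂ r₃, (∀ x, x ∈ Q ↔ x = p₁ ∨ x = p₂ ∨ x = r₁ ∨ x = r₂ ∨ x = r₃) →
      (p₁ ≠ r₁ ∧ p₁ ≠ r₂ ∧ p₁ ≠ r₃) → (p₂ ≠ r₁ ∧ p₂ ≠ r₂ ∧ p₂ ≠ r₃) → T r₁ r₂ r₃ := by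
    intro p₁ p₂ r₁ r₂ r₃ hQ' hp₁ hp₂
    by_contra hr
    exact hno ⟨_, hT.colorsBlock_two_three hQ' hp₁ hp₂ hr
      (hcl _ (by grind) _ (by grind)) (hcl _ (by grind) _ (by grind))
      (hcl _ (by grind) _ (by grind)) (hcl _ (by grind) _ (by grind))⟩
  obtain ⟨h1, h2, h3, h4, h5, h6, h7, h8, h9, h0⟩ := hd
  refine hT.no_complete (a := a) (b := b) (c := c) (d := d) (e := e)
    (key d e _ _ _ ?_ ?_ ?_) (key c e _ _ _ ?_ ?_ ?_) (key c d _ _ _ ?_ ?_ ?_)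
    (key b e _ _ _ ?_ ?_ ?_) (key b d _ _ _ ?_ ?_ ?_) (key b c _ _ _ ?_ ?_ ?_)
    (key a e _ _ _ ?_ ?_ ?_) (key a d _ _ _ ?_ ?_ ?_) (key a c _ _ _ ?_ ?_ ?_)
    (key a b _ _ _ ?_ ?_ ?_) <;> grind

theorem colorsBlock_two_two (hT : IsLocalSystem T) {Q : Set α} {p₁ p₂ r₁ r₂ : α}
    (hQ : ∀ x, x ∈ Q ↔ x = p₁ ∨ x = p₂ ∨ x = r₁ ∨ x = r₂)
    (hp₁ : p₁ ≠ r₁ ∧ p₁ ≠ r₂) (hp₂ : p₂ ≠ r₁ ∧ p₂ ≠ r₂)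
    (hp : ∀ t, T p₁ p₂ t → t ∈ Q) (hr : ∀ t, T r₁ r₂ t → t ∈ Q) :
    ColorsBlock T Q (fun x => x = p₁ ∨ x = p₂) := by
  intro a b c habc ha hb hab
  have hne := hT.ne' habc
  have s1 := @hT.swap
  have s2 := @hT.rot
  rw [hQ] at ha hb
  have hc : c ∈ Q := by
    rcases ha with rfl | rfl | rfl | rfl <;> rcases hb with rfl | rfl | rfl | rfl <;> grind
  refine ⟨hc, ?_⟩
  rw [hQ] at hc
  grind

/-- The four triples alone give connectivity and separation, whatever the coloring: only the pairs
`a z` and `y z` may need two-triple paths, both through `c`, and separation never uses equality of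
colors. -/
theorem fan_block (hT : IsLocalSystem T) {a b c y z : α} (habc : T a b c) (haby : T a b y)
    (hacy : T a c y) (hbcz : T b c z) (hyz : y ≠ z) (hza : z ≠ a) {χ : α → Prop}
    (hχ : ColorsBlock T {a, z, b, c, y} χ) : HasBlock T a b c := by
  have s1 := @hT.swap
  have s2 := @hT.rot
  have n1 := hT.ne' habc
  have n2 := hT.ne' haby
  have n3 := hT.ne' hacy
  have n4 := hT.ne' hbcz
  have hQ : ∀ x, x ∈ ({a, z, b, c, y} : Set α) ↔ x = a ∨ x = z ∨ x = b ∨ x = c ∨ x = y := by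
    intro x; simp
  refine ⟨_, χ, by simp, by simp, by simp, fun q hq => ⟨hχ, ?_, ?_⟩⟩
  · have j : ∀ {u v w}, T u v w → w ∈ ({a, z, b, c, y} : Set α) →
      JoinedIn T {a, z, b, c, y} u v := fun h hw => Or.inl ⟨_, hw, h⟩
    have j₁ : JoinedIn T {a, z, b, c, y} a z :=
      Or.inr ⟨c, by grind, y, by grind, b, by grind, by grind, by grind, by grind, by grind,
        by grind⟩
    have j₂ : JoinedIn T {a, z, b, c, y} y z :=
      Or.inr ⟨c, by grind, a, by grind, b, by grind, by grind, by grind, by grind, by grind,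
        by grind⟩
    have s3 := hT.joinedIn_symm j₁
    have s4 := hT.joinedIn_symm j₂
    intro u hu v hv huv
    rw [hQ] at hu hv
    rcases hu with rfl | rfl | rfl | rfl | rfl <;> rcases hv with rfl | rfl | rfl | rfl | rfl <;>
      first
        | exact absurd rfl huv
        | assumption
        | grind
  · intro u hu v hv huv huq hvq _
    rw [hQ] at hu hv
    have s5 := @hT.swap
    rcases hq with rfl | rfl | rfl <;> rcases hu with rfl | rfl | rfl | rfl | rfl <;>
      rcases hv with rfl | rfl | rfl | rfl | rfl <;> grind

/-- The five points of triples `abc`, `aby`, `acy`, `bcz` form a block if `bc` lies in no further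
triple. -/
theorem hasBlock_of_fan (hT : IsLocalSystem T) {a b c y z : α} (habc : T a b c) (haby : T a b y)
    (hacy : T a c y) (hbcz : T b c z) (hyz : y ≠ z) (hza : z ≠ a)
    (hZ : ∀ t, T b c t → t = a ∨ t = z) : HasBlock T a b c := by
  have s1 := @hT.swap
  have s2 := @hT.rot
  have n1 := hT.ne' habc
  have n2 := hT.ne' haby
  have n3 := hT.ne' hacy
  have n4 := hT.ne' hbcz
  have hQ : ∀ x, x ∈ ({a, z, b, c, y} : Set α) ↔ x = a ∨ x = z ∨ x = b ∨ x = c ∨ x = y := by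
    intro x; simp
  -- The classes are `{a, z}` and `{b, c, y}`. The latter is not a triple, by `hZ`. A triple on `a
  -- z`, `b y` or `c y` with third point outside the five would complete a linear triangle.
  refine hT.fan_block habc haby hacy hbcz hyz hza
    (hT.colorsBlock_two_three hQ (by grind) (by grind) ?_ ?_ ?_ ?_ ?_)
  · intro h
    rcases hZ _ h <;> grind
  · intro t ht
    by_contra hn
    have := hT.ne' ht
    exact hT.no_triangle (a := a) (b := z) (c := c) (x := t) (y := b) (z := y) ht
      (by grind) (by grind) (by grind) (by grind) (by grind) (by grind) (by grind) (by grind)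
  · intro t ht
    rcases hZ _ ht <;> grind
  · intro t ht
    by_contra hn
    have := hT.ne' ht
    exact hT.no_triangle (a := b) (b := y) (c := c) (x := t) (y := a) (z := z) ht
      (by grind) (by grind) (by grind) (by grind) (by grind) (by grind) (by grind) (by grind)
  · intro t ht
    by_contra hn
    have := hT.ne' ht
    exact hT.no_triangle (a := c) (b := y) (c := b) (x := t) (y := a) (z := z) ht
      (by grind) (by grind) (by grind) (by grind) (by grind) (by grind) (by grind) (by grind)

/-- The hypotheses confine the third points of the pairs inside `a b c`; linear triangles confine
those of all remaining pairs. The five points are thus closed, and a missing triple supplies the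
coloring. -/
theorem hasBlock_of_full (hT : IsLocalSystem T) {a b c y z : α} (habc : T a b c) (haby : T a b y)
    (habz : T a b z) (hacy : T a c y) (hacz : T a c z) (hbcy : T b c y) (hbcz : T b c z)
    (hyz : y ≠ z) (hab : ∀ t, T a b t → t = c ∨ t = y ∨ t = z)
    (hac : ∀ t, T a c t → t = b ∨ t = y ∨ t = z)
    (hbc : ∀ t, T b c t → t = a ∨ t = y ∨ t = z) : HasBlock T a b c := by
  have s1 := @hT.swap
  have s2 := @hT.rot
  have n1 := hT.ne' habc
  have n2 := hT.ne' haby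
  have n3 := hT.ne' hacy
  have n4 := hT.ne' hbcz
  have n5 := hT.ne' habz
  have hQ : ∀ x, x ∈ ({a, z, b, c, y} : Set α) ↔ x = a ∨ x = z ∨ x = b ∨ x = c ∨ x = y := by
    intro x; simp
  have outer : ∀ {a b c y z}, T a b c → T a b z → T b c y → T a c z → y ≠ z → ∀ t, T a y t →
      t = b ∨ t = c ∨ t = z := by
    intro a b c y z habc habz hbcy hacz hyz t ht
    by_contra hn
    have m1 := hT.ne' ht
    have m2 := hT.ne' habc
    have m3 := hT.ne' habz
    have m4 := hT.ne' hbcy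
    have m5 := hT.ne' hacz
    exact hT.no_triangle (a := a) (b := y) (c := b) (x := t) (y := c) (z := z) ht
      (by have := @hT.swap; have := @hT.rot; grind) (by have := @hT.swap; grind)
      (by grind) (by grind) (by grind) (by grind) (by grind) (by grind)
  have oyz : ∀ t, T y z t → t ∈ ({a, z, b, c, y} : Set α) := by
    intro t ht
    by_contra hn
    have := hT.ne' ht
    exact hT.no_triangle (a := y) (b := z) (c := b) (x := t) (y := c) (z := a) ht
      (by grind) (by grind) (by grind) (by grind) (by grind) (by grind) (by grind) (by grind)
  have o1 := outer habc habz hbcy hacz hyz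
  have o2 := outer habc haby hbcz hacy hyz.symm
  have o3 := outer (hT.swap habc) (hT.swap habz) hacy hbcz hyz
  have o4 := outer (hT.swap habc) (hT.swap haby) hacz hbcy hyz.symm
  have o5 := outer (a := c) (b := a) (c := b) (y := y) (z := z)
    (by grind) (by grind) (by grind) (by grind) hyz
  have o6 := outer (a := c) (b := a) (c := b) (y := z) (z := y)
    (by grind) (by grind) (by grind) (by grind) hyz.symm
  obtain ⟨χ, hχ⟩ := hT.exists_colorsBlock_of_closed hQ (by grind) (by
    intro u hu v hv t ht
    have := hT.ne ht
    rw [hQ] at hu hv ⊢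
    rcases hu with rfl | rfl | rfl | rfl | rfl <;>
      rcases hv with rfl | rfl | rfl | rfl | rfl <;> grind)
  exact hT.fan_block habc haby hacy hbcz hyz (by grind) hχ

/-- The working form of `no_triangle`: two triples forming a path from `q` to `p` through `m` leave
only three possible third points for the pair `p q`. -/
theorem third_eq (hT : IsLocalSystem T) {p q m x y t : α} (h : T p q t) (h₁ : T q m x)
    (h₂ : T m p y) (h₃ : x ≠ y) (h₄ : x ≠ p) (h₅ : y ≠ q) : t = m ∨ t = x ∨ t = y := by
  by_contra hn
  exact hT.no_triangle h h₁ h₂ (by grind) h₃ (by grind) (by grind) h₄ h₅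

/-- The pairs `a c` and `b c` are confined by hypothesis and the other eight by `third_eq`, so the
five points are closed. -/
theorem hasBlock_of_wheel (hT : IsLocalSystem T) {a b c z s : α} (habc : T a b c)
    (hacz : T a c z) (hbcz : T b c z) (hazs : T a z s) (hbzs : T b z s) (habs : T a b s)
    (hcs : c ≠ s) (hac : ∀ t, T a c t → t = b ∨ t = z) (hbc : ∀ t, T b c t → t = a ∨ t = z) :
    HasBlock T a b c := by
  have s1 := @hT.swap
  have s2 := @hT.rot
  have n1 := hT.ne' habc
  have n2 := hT.ne' hacz
  have n3 := hT.ne' hbcz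
  have n4 := hT.ne' hazs
  have n5 := hT.ne' hbzs
  have hQ : ∀ x, x ∈ ({a, b, c, z, s} : Set α) ↔ x = a ∨ x = b ∨ x = c ∨ x = z ∨ x = s := by
    intro x; simp
  have o₁ : ∀ t, T a b t → t = z ∨ t = c ∨ t = s := fun t ht =>
    hT.third_eq ht (m := z) (x := c) (y := s) (by grind) (by grind) (by grind) (by grind) (by grind)
  have o₂ : ∀ t, T a z t → t = b ∨ t = s ∨ t = c := fun t ht =>
    hT.third_eq ht (m := b) (x := s) (y := c) (by grind) (by grind) (by grind) (by grind) (by grind)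
  have o₃ : ∀ t, T b z t → t = a ∨ t = s ∨ t = c := fun t ht =>
    hT.third_eq ht (m := a) (x := s) (y := c) (by grind) (by grind) (by grind) (by grind) (by grind)
  have o₄ : ∀ t, T c z t → t = a ∨ t = s ∨ t = b := fun t ht =>
    hT.third_eq ht (m := a) (x := s) (y := b) (by grind) (by grind) (by grind) (by grind) (by grind)
  have o₅ : ∀ t, T a s t → t = b ∨ t = z ∨ t = c := fun t ht =>
    hT.third_eq ht (m := b) (x := z) (y := c) (by grind) (by grind) (by grind) (by grind) (by grind)
  have o₆ : ∀ t, T b s t → t = a ∨ t = z ∨ t = c := fun t ht =>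
    hT.third_eq ht (m := a) (x := z) (y := c) (by grind) (by grind) (by grind) (by grind) (by grind)
  have o₇ : ∀ t, T c s t → t = a ∨ t = z ∨ t = b := fun t ht =>
    hT.third_eq ht (m := a) (x := z) (y := b) (by grind) (by grind) (by grind) (by grind) (by grind)
  have o₈ : ∀ t, T z s t → t = a ∨ t = b ∨ t = c := fun t ht =>
    hT.third_eq ht (m := a) (x := b) (y := c) (by grind) (by grind) (by grind) (by grind) (by grind)
  obtain ⟨χ, hχ⟩ := hT.exists_colorsBlock_of_closed hQ (by grind) (by
    intro u hu v hv t ht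
    have := hT.ne ht
    rw [hQ] at hu hv ⊢
    rcases hu with rfl | rfl | rfl | rfl | rfl <;>
      rcases hv with rfl | rfl | rfl | rfl | rfl <;> grind)
  refine ⟨_, χ, by simp, by simp, by simp, fun q hq => ⟨hχ, ?_, ?_⟩⟩
  · have j : ∀ {u v w}, T u v w → w ∈ ({a, b, c, z, s} : Set α) →
      JoinedIn T {a, b, c, z, s} u v := fun h hw => Or.inl ⟨_, hw, h⟩
    have j₁ : JoinedIn T {a, b, c, z, s} c s :=
      Or.inr ⟨a, by grind, b, by grind, z, by grind, by grind, by grind, by grind, by grind,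
        by grind⟩
    have s3 := hT.joinedIn_symm j₁
    intro u hu v hv huv
    rw [hQ] at hu hv
    rcases hu with rfl | rfl | rfl | rfl | rfl <;> rcases hv with rfl | rfl | rfl | rfl | rfl <;>
      first
        | exact absurd rfl huv
        | assumption
        | grind
  · intro u hu v hv huv huq hvq _
    rw [hQ] at hu hv
    rcases hq with rfl | rfl | rfl <;> rcases hu with rfl | rfl | rfl | rfl | rfl <;>
      rcases hv with rfl | rfl | rfl | rfl | rfl <;> grind

/-- The classes `{a, z}` and `{b, c, s}` work: `hbc` prevents `b c s` from being a triple, and the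
pairs inside the classes have all their third points among the five. -/
theorem hasBlock_of_cone (hT : IsLocalSystem T) {a b c z s : α} (habc : T a b c)
    (hacz : T a c z) (hbcz : T b c z) (habz : T a b z) (hazs : T a z s) (hbzs : T b z s)
    (hczs : T c z s) (hbc : ∀ t, T b c t → t = a ∨ t = z) :
    HasBlock T a b c := by
  have s1 := @hT.swap
  have s2 := @hT.rot
  have n1 := hT.ne' habc
  have n2 := hT.ne' hacz
  have n3 := hT.ne' hbcz
  have n4 := hT.ne' hazs
  have n5 := hT.ne' hbzs
  have n6 := hT.ne' hczs
  have hQ : ∀ x, x ∈ ({a, z, b, c, s} : Set α) ↔ x = a ∨ x = z ∨ x = b ∨ x = c ∨ x = s := by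
    intro x; simp
  have o₁ : ∀ t, T a z t → t = b ∨ t = s ∨ t = c := fun t ht =>
    hT.third_eq ht (m := b) (x := s) (y := c) (by grind) (by grind) (by grind) (by grind) (by grind)
  have o₂ : ∀ t, T b s t → t = a ∨ t = z ∨ t = c := fun t ht =>
    hT.third_eq ht (m := a) (x := z) (y := c) (by grind) (by grind) (by grind) (by grind) (by grind)
  have o₃ : ∀ t, T c s t → t = a ∨ t = z ∨ t = b := fun t ht =>
    hT.third_eq ht (m := a) (x := z) (y := b) (by grind) (by grind) (by grind) (by grind) (by grind)
  have hχ : ColorsBlock T {a, z, b, c, s} (fun x => x = a ∨ x = z) :=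
    hT.colorsBlock_two_three hQ (by grind) (by grind) (by grind) (by grind) (by grind) (by grind)
      (by grind)
  refine ⟨_, _, by simp, by simp, by simp, fun q hq => ⟨hχ, ?_, ?_⟩⟩
  · have j : ∀ {u v w}, T u v w → w ∈ ({a, z, b, c, s} : Set α) →
      JoinedIn T {a, z, b, c, s} u v := fun h hw => Or.inl ⟨_, hw, h⟩
    intro u hu v hv huv
    rw [hQ] at hu hv
    rcases hu with rfl | rfl | rfl | rfl | rfl <;> rcases hv with rfl | rfl | rfl | rfl | rfl <;>
      first
        | exact absurd rfl huv
        | grind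
  · intro u hu v hv huv huq hvq _
    rw [hQ] at hu hv
    rcases hq with rfl | rfl | rfl <;> rcases hu with rfl | rfl | rfl | rfl | rfl <;>
      rcases hv with rfl | rfl | rfl | rfl | rfl <;> grind

theorem four_block (hT : IsLocalSystem T) {a b c z : α} (habc : T a b c) (hacz : T a c z)
    (hbcz : T b c z) {χ : α → Prop} (hχ : ColorsBlock T {a, b, c, z} χ) : HasBlock T a b c := by
  have s1 := @hT.swap
  have s2 := @hT.rot
  have n1 := hT.ne' habc
  have n2 := hT.ne' hacz
  have n3 := hT.ne' hbcz
  have hQ : ∀ x, x ∈ ({a, b, c, z} : Set α) ↔ x = a ∨ x = b ∨ x = c ∨ x = z := by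
    intro x; simp
  refine ⟨_, _, by simp, by simp, by simp, fun q hq => ⟨hχ, ?_, ?_⟩⟩
  · have j : ∀ {u v w}, T u v w → w ∈ ({a, b, c, z} : Set α) →
      JoinedIn T {a, b, c, z} u v := fun h hw => Or.inl ⟨_, hw, h⟩
    intro u hu v hv huv
    rw [hQ] at hu hv
    rcases hu with rfl | rfl | rfl | rfl <;> rcases hv with rfl | rfl | rfl | rfl <;>
      first
        | exact absurd rfl huv
        | grind
  · intro u hu v hv huv huq hvq _
    rw [hQ] at hu hv
    rcases hq with rfl | rfl | rfl <;> rcases hu with rfl | rfl | rfl | rfl <;>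
      rcases hv with rfl | rfl | rfl | rfl <;> grind

/-- The four points `a, b, c, z` suffice if one of their splits into two pairs has both pairs
confined to them. When all three splits fail, the obstructing triples share one outside point `s`,
and the fifth point `s` yields a wheel or a cone. -/
theorem hasBlock_of_twin (hT : IsLocalSystem T) {a b c z x : α} (habc : T a b c)
    (hacz : T a c z) (hbcz : T b c z) (habx : T a b x) (hxc : x ≠ c)
    (hac : ∀ t, T a c t → t = b ∨ t = z) (hbc : ∀ t, T b c t → t = a ∨ t = z) :
    HasBlock T a b c := by
  have s1 := @hT.swap
  have s2 := @hT.rot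
  have n1 := hT.ne' habc
  have n2 := hT.ne' hacz
  have n3 := hT.ne' hbcz
  have n4 := hT.ne' habx
  have hQ : ∀ x, x ∈ ({a, b, c, z} : Set α) ↔ x = a ∨ x = b ∨ x = c ∨ x = z := by
    intro x; simp
  by_cases e₁ : ∀ t, T b z t → t = a ∨ t = c
  · exact hT.four_block habc hacz hbcz
      (hT.colorsBlock_two_two (p₁ := a) (p₂ := c) (r₁ := b) (r₂ := z) (by grind) (by grind)
        (by grind) (by grind) (by grind))
  by_cases e₂ : ∀ t, T a z t → t = b ∨ t = c
  · exact hT.four_block habc hacz hbcz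
      (hT.colorsBlock_two_two (p₁ := b) (p₂ := c) (r₁ := a) (r₂ := z) (by grind) (by grind)
        (by grind) (by grind) (by grind))
  push Not at e₁ e₂
  obtain ⟨s, hbzs, hsa, hsc⟩ := e₁
  obtain ⟨s', hazs, hsb', hsc'⟩ := e₂
  have : s' = s := by
    have := hT.third_eq hazs (m := b) (x := s) (y := c) (by grind) (by grind) (by grind) (by grind)
      (by grind)
    grind
  subst this
  by_cases habs : T a b s'
  · exact hT.hasBlock_of_wheel habc hacz hbcz hazs hbzs habs hsc.symm hac hbc
  have hab : ∀ t, T a b t → t = c ∨ t = z := by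
    intro t ht
    by_contra hn
    have m := hT.ne' ht
    have := hT.third_eq ht (m := z) (x := c) (y := s') (by grind) (by grind) (by grind) (by grind)
      (by grind)
    grind
  have habz : T a b z := by
    rcases hab x habx with rfl | rfl
    · exact absurd rfl hxc
    · exact habx
  by_cases e₃ : ∀ t, T c z t → t = a ∨ t = b
  · exact hT.four_block habc hacz hbcz
      (hT.colorsBlock_two_two (p₁ := a) (p₂ := b) (r₁ := c) (r₂ := z) (by grind) (by grind)
        (by grind) (by grind) (by grind))
  push Not at e₃
  obtain ⟨t, hczt, hta, htb⟩ := e₃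
  have : t = s' := by
    have := hT.third_eq hczt (m := a) (x := s') (y := b) (by grind) (by grind) (by grind) (by grind)
      (by grind)
    grind
  subst this
  exact hT.hasBlock_of_cone habc hacz hbcz habz hazs hbzs hczt hbc

end IsLocalSystem
-- Existence of a block through every triple
theorem HasBlock.rotate {α : Type*} {T : α → α → α → Prop} {a b c : α} (h : HasBlock T a b c) :
    HasBlock T b c a := by
  obtain ⟨B, χ, ha, hb, hc, h⟩ := h
  exact ⟨B, χ, hb, hc, ha, fun q hq => h q (by tauto)⟩

theorem HasBlock.swap {α : Type*} {T : α → α → α → Prop} {a b c : α} (h : HasBlock T a b c) :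
    HasBlock T b a c := by
  obtain ⟨B, χ, ha, hb, hc, h⟩ := h
  exact ⟨B, χ, hb, ha, hc, fun q hq => h q (by tauto)⟩

namespace IsLocalSystem

variable {α : Type*} {T : α → α → α → Prop}

theorem eq_of_three (hT : IsLocalSystem T) {a b c x w y : α} (hx : T a b x) (hw : T b c w)
    (hy : T a c y) (hxc : x ≠ c) (hwa : w ≠ a) (hyb : y ≠ b) : x = w ∨ w = y ∨ x = y := by
  by_contra! hn
  exact hT.no_triangle hx hw (hT.swap hy) hn.1 hn.2.1 hn.2.2 hxc hwa hyb

/-- By `eq_of_three`, the third points of `a b` and `b c` other than those of the triple are `y` or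
`z`. Which of `b c y`, `a b y`, `a b z` are triples then decides between the full, fan and twin
configurations, up to a rotation. -/
theorem hasBlock_of_two (hT : IsLocalSystem T) {a b c x y z : α} (habc : T a b c)
    (habx : T a b x) (hxc : x ≠ c) (hacy : T a c y) (hyb : y ≠ b) (hacz : T a c z)
    (hbcz : T b c z) (hyz : y ≠ z) : HasBlock T a b c := by
  have s1 := @hT.swap
  have s2 := @hT.rot
  have n1 := hT.ne' habc
  have n2 := hT.ne' hacy
  have n3 := hT.ne' hacz
  have n4 := hT.ne' hbcz
  have n5 := hT.ne' habx
  have hab : ∀ t, T a b t → t = c ∨ t = y ∨ t = z := by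
    intro t ht
    have := hT.eq_of_three ht hbcz hacy
    grind
  have hbc : ∀ t, T b c t → t = a ∨ t = y ∨ t = z := by
    intro t ht
    have h₁ := hT.eq_of_three habx ht hacy
    have h₂ := hT.eq_of_three habx ht hacz
    have h₃ := hab x habx
    grind
  by_cases hbcy : T b c y
  · have hac : ∀ t, T a c t → t = b ∨ t = y ∨ t = z := by
      intro t ht
      have h₁ := hT.eq_of_three habx hbcy ht
      have h₂ := hT.eq_of_three habx hbcz ht
      have h₃ := hab x habx
      grind
    by_cases haby : T a b y
    · by_cases habz : T a b z
      · exact hT.hasBlock_of_full habc haby habz hacy hacz hbcy hbcz hyz hab hac hbc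
      · exact (hT.hasBlock_of_fan (a := c) (b := a) (c := b) (y := z) (z := y) (by grind)
          (by grind) (by grind) (by grind) (by grind) (by grind) (by grind)).rotate
    · have habz : T a b z := by
        have := hab x habx
        grind
      exact (hT.hasBlock_of_fan (a := c) (b := a) (c := b) (y := y) (z := z) (by grind)
          (by grind) (by grind) (by grind) (by grind) (by grind) (by grind)).rotate
  · by_cases haby : T a b y
    · exact hT.hasBlock_of_fan habc haby hacy hbcz hyz (by grind) (by grind)
    · have habz : T a b z := by
        have := hab x habx
        grind
      exact (hT.hasBlock_of_twin (a := c) (b := a) (c := b) (z := z) (x := y) (by grind) (by grind)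
        (by grind) (by grind) hyb (by grind) (by grind)).rotate

theorem hasBlock_of_common (hT : IsLocalSystem T) {a b c x z : α} (habc : T a b c)
    (habx : T a b x) (hxc : x ≠ c) (hacz : T a c z) (hbcz : T b c z) : HasBlock T a b c := by
  by_cases h₁ : ∀ t, T a c t → t = b ∨ t = z
  · by_cases h₂ : ∀ t, T b c t → t = a ∨ t = z
    · exact hT.hasBlock_of_twin habc hacz hbcz habx hxc h₁ h₂
    · push Not at h₂
      obtain ⟨y, hy, hya, hyz⟩ := h₂
      exact (hT.hasBlock_of_two (hT.swap habc) (hT.swap habx) hxc hy hya hbcz hacz hyz).swap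
  · push Not at h₁
    obtain ⟨y, hy, hyb, hyz⟩ := h₁
    exact hT.hasBlock_of_two habc habx hxc hy hyb hacz hbcz hyz

/-- A triple each of whose pairs lies in another triple belongs to a block. -/
theorem hasBlock_of_extensions (hT : IsLocalSystem T) {a b c x y w : α} (habc : T a b c)
    (habx : T a b x) (hxc : x ≠ c) (hacy : T a c y) (hyb : y ≠ b) (hbcw : T b c w)
    (hwa : w ≠ a) : HasBlock T a b c := by
  have s1 := @hT.swap
  have s2 := @hT.rot
  rcases hT.eq_of_three habx hbcw hacy hxc hwa hyb with rfl | rfl | rfl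
  · exact (hT.hasBlock_of_common (a := c) (b := a) (c := b) (z := x) (x := y) (by grind) (by grind)
      hyb (by grind) (by grind)).rotate
  · exact hT.hasBlock_of_common habc habx hxc hacy hbcw
  · exact (hT.hasBlock_of_common (a := b) (b := c) (c := a) (z := x) (x := w) (by grind) (by grind)
      hwa (by grind) (by grind)).rotate.rotate

theorem blockConnected_triple (hT : IsLocalSystem T) {q s t : α} (h : T q s t) :
    BlockConnected T {q, s, t} := by
  have s1 := @hT.swap
  have s2 := @hT.rot
  intro u hu v hv huv
  simp only [Set.mem_insert_iff, Set.mem_singleton_iff] at hu hv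
  have j : ∀ {u v w}, T u v w → w ∈ ({q, s, t} : Set α) →
    JoinedIn T {q, s, t} u v := fun h hw => Or.inl ⟨_, hw, h⟩
  rcases hu with rfl | rfl | rfl <;> rcases hv with rfl | rfl | rfl <;>
    first
      | exact absurd rfl huv
      | grind

/-- Every triple belongs to a block rooted at any of its points. -/
theorem exists_isBlock (hT : IsLocalSystem T) {q s t : α} (h : T q s t) :
    ∃ (B : Set α) (χ : α → Prop), q ∈ B ∧ s ∈ B ∧ IsBlock T q B χ := by
  have s1 := @hT.swap
  have s2 := @hT.rot
  have n1 := hT.ne' h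
  have hmem : ∀ x, x ∈ ({q, s, t} : Set α) ↔ x = q ∨ x = s ∨ x = t := by intro x; simp
  by_cases hqs : ∀ x, T q s x → x = t
  -- The only pair of equal color is `q s`, whose only third point is `t`; separation is vacuous.
  · refine ⟨{q, s, t}, fun x => x = t, by simp, by simp, ?_, hT.blockConnected_triple h, ?_⟩
    · intro a b c habc ha hb hab
      have := hT.ne' habc
      rw [hmem] at ha hb ⊢
      rcases ha with rfl | rfl | rfl <;> rcases hb with rfl | rfl | rfl <;> grind
    · intro b hb c hc hbc hbq hcq hχ
      rw [hmem] at hb hc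
      grind
  by_cases hqt : ∀ x, T q t x → x = s
  · refine ⟨{q, s, t}, fun x => x = s, by simp, by simp, ?_, hT.blockConnected_triple h, ?_⟩
    · intro a b c habc ha hb hab
      have := hT.ne' habc
      rw [hmem] at ha hb ⊢
      rcases ha with rfl | rfl | rfl <;> rcases hb with rfl | rfl | rfl <;> grind
    · intro b hb c hc hbc hbq hcq hχ
      rw [hmem] at hb hc
      grind
  push Not at hqs hqt
  obtain ⟨x, hx, hxt⟩ := hqs
  obtain ⟨y, hy, hys⟩ := hqt
  by_cases hst : ∀ x, T s t x → x = q
  -- Here `s` and `t` share a color, so separation is not vacuous; the extra triples `q s x` and `q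
  -- t y` provide it.
  · refine ⟨{q, s, t}, fun x => x = q, by simp, by simp, ?_, hT.blockConnected_triple h, ?_⟩
    · intro a b c habc ha hb hab
      have := hT.ne' habc
      rw [hmem] at ha hb ⊢
      rcases ha with rfl | rfl | rfl <;> rcases hb with rfl | rfl | rfl <;> grind
    · intro b hb c hc hbc hbq hcq hχ
      rw [hmem] at hb hc
      grind
  push Not at hst
  obtain ⟨w, hw, hwq⟩ := hst
  obtain ⟨B, χ, hq, hs, -, hB⟩ := hT.hasBlock_of_extensions h hx hxt hy hys hw hwq
  exact ⟨B, χ, hq, hs, hB q (Or.inl rfl)⟩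

end IsLocalSystem
-- Linear paths and their closure to linear cycles
/-- `IsLinPath E n U a b`: some linear path of `n` edges of `E` from `a` to `b` has vertex set
`U`. -/
inductive IsLinPath {α : Type*} (E : Set (Set α)) : ℕ → Set α → α → α → Prop
  | single {e : Set α} {a b : α} (he : e ∈ E) (ha : a ∈ e) (hb : b ∈ e) (hab : a ≠ b) :
      IsLinPath E 1 e a b
  | cons {n : ℕ} {e U : Set α} {a c b : α} (he : e ∈ E) (ha : a ∈ e) (hac : a ≠ c)
      (hU : e ∩ U = {c}) (h : IsLinPath E n U c b) : IsLinPath E (n + 1) (e ∪ U) a b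

namespace IsLinPath

variable {α : Type*} {E F : Set (Set α)} {n : ℕ} {U : Set α} {a b : α}

theorem left_mem (h : IsLinPath E n U a b) : a ∈ U := by
  cases h with
  | single he ha hb hab => exact ha
  | cons he ha hac hU h => exact Or.inl ha

theorem right_mem (h : IsLinPath E n U a b) : b ∈ U := by
  induction h with
  | single he ha hb hab => exact hb
  | cons he ha hac hU h ih => exact Or.inr ih

theorem pos (h : IsLinPath E n U a b) : 1 ≤ n := by
  cases h <;> omega

theorem ne (h : IsLinPath E n U a b) : a ≠ b := by
  cases h with
  | single he ha hb hab => exact hab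
  | @cons n e U a c b he ha hac hU h =>
    rintro rfl
    have : a ∈ e ∩ U := ⟨ha, h.right_mem⟩
    rw [hU] at this
    exact hac this

theorem mono (h : IsLinPath E n U a b) (hEF : E ⊆ F) : IsLinPath F n U a b := by
  induction h with
  | single he ha hb hab => exact single (hEF he) ha hb hab
  | cons he ha hac hU h ih => exact cons (hEF he) ha hac hU ih

theorem append (h : IsLinPath E n U a b) {m : ℕ} {W : Set α} {c : α} (h' : IsLinPath E m W b c)
    (hUW : U ∩ W = {b}) : IsLinPath E (n + m) (U ∪ W) a c := by
  induction h with
  | single he ha hb hab =>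
    rw [Nat.add_comm]
    exact cons he ha hab hUW h'
  | @cons n e U a d b he ha had hU h ih =>
    have hb := h.right_mem
    have hUW' : U ∩ W = {b} := by
      ext x
      have := Set.ext_iff.mp hUW x
      have := Set.ext_iff.mp hUW b
      simp only [Set.mem_inter_iff, Set.mem_union, Set.mem_singleton_iff] at *
      grind
    have := ih h' hUW'
    rw [Set.union_assoc, Nat.add_right_comm]
    refine cons he ha had ?_ this
    ext x
    have h₁ := Set.ext_iff.mp hUW x
    have h₂ := Set.ext_iff.mp hU x
    simp only [Set.mem_inter_iff, Set.mem_union, Set.mem_singleton_iff] at *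
    grind

/-- The vertices and edges of a linear path, listed in order. -/
theorem exists_seq (h : IsLinPath E n U a b) :
    ∃ (v : ℕ → α) (f : ℕ → Set α), v 0 = a ∧ v n = b ∧ (∀ i < n, f i ∈ E) ∧
      (∀ i < n, f i ⊆ U) ∧ (∀ i < n, v i ∈ f i) ∧ (∀ i < n, v (i + 1) ∈ f i) ∧
      (∀ i ≤ n, ∀ j ≤ n, v i = v j → i = j) ∧
      (∀ i, i + 1 < n → f i ∩ f (i + 1) = {v (i + 1)}) ∧
      ∀ i j, i + 1 < j → j < n → f i ∩ f j = ∅ := by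
  induction h with
  | @single e a b he ha hb hab =>
    refine ⟨fun i => if i = 0 then a else b, fun _ => e, by simp, by simp, fun _ _ => he,
      fun _ _ => subset_rfl, ?_, ?_, ?_, ?_, ?_⟩
    · intro i _; dsimp only; split_ifs <;> assumption
    · intro i _; simpa using hb
    · intro i hi j hj; interval_cases i <;> interval_cases j <;> simp [hab, hab.symm]
    · intro i hi; omega
    · intro i j hi hj; omega
  | @cons n e U a c b he ha hac hU h ih =>
    obtain ⟨v, f, h0, hn, hE, hsub, hv, hv', hinj, hcon, hfar⟩ := ih
    have hpos := h.pos
    have haU : a ∉ U := fun haU => hac (by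
      have : a ∈ e ∩ U := ⟨ha, haU⟩
      rwa [hU] at this)
    have hvU : ∀ i ≤ n, v i ∈ U := by
      intro i hi
      rcases Nat.lt_or_ge i n with h | h
      · exact hsub i h (hv i h)
      · obtain ⟨k, rfl⟩ : ∃ k, i = k + 1 := ⟨i - 1, by omega⟩
        exact hsub k (by omega) (hv' k (by omega))
    have hc : c ∈ e := by
      have : c ∈ e ∩ U := by rw [hU]; rfl
      exact this.1
    refine ⟨fun i => Nat.casesOn i a v, fun i => Nat.casesOn i e f, rfl, hn, ?_, ?_, ?_, ?_, ?_,
      ?_, ?_⟩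
    · rintro (_ | i) hi
      · exact he
      · exact hE i (by omega)
    · rintro (_ | i) hi
      · exact Set.subset_union_left
      · exact (hsub i (by omega)).trans Set.subset_union_right
    · rintro (_ | i) hi
      · exact ha
      · exact hv i (by omega)
    · rintro (_ | i) hi
      · change v 0 ∈ e
        rwa [h0]
      · exact hv' i (by omega)
    · rintro (_ | i) hi (_ | j) hj hij
      · rfl
      · exact absurd ((show a = v j from hij) ▸ hvU j (by omega)) haU
      · exact absurd ((show v i = a from hij) ▸ hvU i (by omega)) haU
      · rw [hinj i (by omega) j (by omega) hij]
    · rintro (_ | i) hi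
      · change e ∩ f 0 = {v 0}
        rw [h0]
        refine Set.Subset.antisymm ?_ ?_
        · rw [← hU]
          exact Set.inter_subset_inter_right _ (hsub 0 (by omega))
        · rintro x rfl
          exact ⟨hc, h0 ▸ hv 0 (by omega)⟩
      · exact hcon i (by omega)
    · rintro (_ | i) (_ | j) hij hj
      · omega
      · change e ∩ f j = ∅
        rw [Set.eq_empty_iff_forall_notMem]
        rintro x ⟨hxe, hxj⟩
        have hx : x ∈ e ∩ U := ⟨hxe, hsub j (by omega) hxj⟩
        rw [hU, Set.mem_singleton_iff, ← h0] at hx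
        subst hx
        rcases Nat.lt_or_ge 1 j with h1 | h1
        · have : v 0 ∈ f 0 ∩ f j := ⟨hv 0 (by omega), hxj⟩
          rw [hfar 0 j h1 (by omega)] at this
          exact this
        · obtain rfl : j = 1 := by omega
          have : v 0 ∈ f 0 ∩ f 1 := ⟨hv 0 (by omega), hxj⟩
          rw [hcon 0 (by omega)] at this
          exact absurd (hinj 0 (by omega) 1 (by omega) this) (by omega)
      · omega
      · exact hfar i j (by omega) (by omega)

/-- An edge that meets a linear path with at least two edges exactly in its ends closes a linear
cycle. -/
theorem not_linearCycleFree {H : Hypergraph α} (h : IsLinPath H.edgeSet n U a b) (hn : 2 ≤ n)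
    {k : Set α} (hk : k ∈ H.edgeSet) (hkU : k ∩ U = {a, b}) : ¬ H.LinearCycleFree := by
  obtain ⟨v, f, h0, hvn, hE, hsub, hv, hv', hinj, hcon, hfar⟩ := h.exists_seq
  intro hfree
  have hne := h.ne
  have hak : a ∈ k := by
    have : a ∈ k ∩ U := by rw [hkU]; simp
    exact this.1
  have hbk : b ∈ k := by
    have : b ∈ k ∩ U := by rw [hkU]; simp
    exact this.1
  have ha : ∀ i, 0 < i → i < n → a ∉ f i := by
    intro i hi hin hai
    have hmem : v 0 ∈ f 0 ∩ f i := ⟨hv 0 (by omega), h0 ▸ hai⟩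
    rcases Nat.lt_or_ge 1 i with h1 | h1
    · rw [hfar 0 i h1 hin] at hmem
      exact hmem
    · obtain rfl : i = 1 := by omega
      rw [hcon 0 hin] at hmem
      exact absurd (hinj 0 (by omega) 1 (by omega) hmem) (by omega)
  obtain ⟨m, rfl⟩ : ∃ m, n = m + 1 := ⟨n - 1, by omega⟩
  have hb : ∀ i < m, b ∉ f i := by
    intro i him hbi
    have hmem : v (m + 1) ∈ f i ∩ f m := ⟨hvn ▸ hbi, hv' m (by omega)⟩
    rcases Nat.lt_or_ge (i + 1) m with h1 | h1
    · rw [hfar i m h1 (by omega)] at hmem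
      exact hmem
    · obtain rfl : m = i + 1 := by omega
      rw [hcon i (by omega)] at hmem
      exact absurd (hinj _ (by omega) _ (by omega) hmem) (by omega)
  have hkf : ∀ i < m + 1, ∀ x, x ∈ k → x ∈ f i → (x = a ∧ i = 0) ∨ (x = b ∧ i = m) := by
    intro i hi x hxk hxi
    have hx : x ∈ k ∩ U := ⟨hxk, hsub i hi hxi⟩
    rw [hkU] at hx
    rcases hx with rfl | hx
    · exact Or.inl ⟨rfl, by by_contra h; exact ha i (by omega) hi hxi⟩
    · rw [Set.mem_singleton_iff] at hx
      subst hx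
      exact Or.inr ⟨rfl, by by_contra h; exact hb i (by omega) hxi⟩
  -- The closing edge takes index `m + 1` and starts at `v (m + 1) = b`, so the cycle has length `m
  -- + 2`.
  let g : ℕ → Set α := fun i => if i < m + 1 then f i else k
  have g1 : ∀ i, i < m + 1 → g i = f i := fun i hi => if_pos hi
  have g2 : g (m + 1) = k := if_neg (by omega)
  have gmem : ∀ i ≤ m + 1, g i ∈ H.edgeSet := by
    intro i hi
    rcases Nat.lt_or_ge i (m + 1) with h | h
    · rw [g1 i h]; exact hE i h
    · obtain rfl : i = m + 1 := by omega
      rw [g2]; exact hk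
  have gcon : ∀ i, i < m + 1 → g i ∩ g (i + 1) = {v (i + 1)} := by
    intro i hi
    rcases Nat.lt_or_ge i m with h | h
    · rw [g1 i hi, g1 (i + 1) (by omega)]
      exact hcon i (by omega)
    · obtain rfl : i = m := by omega
      rw [g1 i hi, g2, hvn]
      refine Set.Subset.antisymm ?_ ?_
      · rintro x ⟨hxf, hxk⟩
        rcases hkf i hi x hxk hxf with ⟨_, h⟩ | ⟨h, _⟩
        · omega
        · exact h
      · rintro x rfl
        exact ⟨hvn ▸ hv' i hi, hbk⟩
  have gfl : g 0 ∩ g (m + 1) = {v 0} := by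
    rw [g1 0 (by omega), g2, h0]
    refine Set.Subset.antisymm ?_ ?_
    · rintro x ⟨hxf, hxk⟩
      rcases hkf 0 (by omega) x hxk hxf with ⟨h, _⟩ | ⟨_, h⟩
      · exact h
      · omega
    · rintro x rfl
      exact ⟨h0 ▸ hv 0 (by omega), hak⟩
  have gfar : ∀ i j, i + 1 < j → j ≤ m + 1 → (0 < i ∨ j ≤ m) → g i ∩ g j = ∅ := by
    intro i j hij hj hor
    rcases Nat.lt_or_ge j (m + 1) with h | h
    · rw [g1 i (by omega), g1 j h]
      exact hfar i j hij h
    · obtain rfl : j = m + 1 := by omega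
      rw [g1 i (by omega), g2, Set.eq_empty_iff_forall_notMem]
      rintro x ⟨hxf, hxk⟩
      rcases hkf i (by omega) x hxk hxf with ⟨_, h⟩ | ⟨_, h⟩ <;> omega
  have gv : ∀ i ≤ m + 1, v i ∈ g i := by
    intro i hi
    rcases Nat.lt_or_ge i (m + 1) with h | h
    · rw [g1 i h]; exact hv i h
    · obtain rfl : i = m + 1 := by omega
      rw [g2, hvn]; exact hbk
  have gv' : ∀ i ≤ m + 1, ∃ x ∈ g i, x ≠ v i := by
    intro i hi
    rcases Nat.lt_or_ge i (m + 1) with h | h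
    · exact ⟨v (i + 1), g1 i h ▸ hv' i h, fun e => absurd (hinj _ (by omega) _ (by omega) e)
        (by omega)⟩
    · obtain rfl : i = m + 1 := by omega
      exact ⟨a, g2 ▸ hak, hvn ▸ hne⟩
  -- Two equal edges would equal their prescribed intersection, which is empty or a single vertex;
  -- yet `g j` contains `v j` and a further point.
  have ginj : ∀ i j, i < j → j ≤ m + 1 → g i ≠ g j := by
    intro i j hij hj hg
    have hself : ∀ s : Set α, g i ∩ g j = s → g j = s := fun s hs => by
      rwa [hg, Set.inter_self] at hs
    have hvj := gv j hj
    obtain ⟨x, hx, hxv⟩ := gv' j hj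
    rcases Nat.lt_or_ge (i + 1) j with h1 | h1
    · by_cases hor : 0 < i ∨ j ≤ m
      · rw [hself _ (gfar i j h1 hj hor)] at hvj
        exact hvj
      · obtain ⟨rfl, rfl⟩ : i = 0 ∧ j = m + 1 := by omega
        rw [hself _ gfl] at hvj
        exact absurd (hinj _ (by omega) _ (by omega) hvj) (by omega)
    · obtain rfl : j = i + 1 := by omega
      rw [hself _ (gcon i (by omega))] at hx
      exact hxv hx
  refine hfree (m + 2) (fun i => v i) (fun i => g i) ⟨by omega, ?_, ?_, ?_, ?_, ?_, ?_, ?_⟩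
  · intro i
    exact H.subset_vertexSet_of_mem_edgeSet (gmem i (by omega)) (gv i (by omega))
  · intro i
    exact gmem i (by omega)
  · intro i j hij
    exact Fin.ext (hinj i (by omega) j (by omega) hij)
  · intro i j hij
    rcases lt_trichotomy (i : ℕ) j with h | h | h
    · exact absurd hij (ginj i j h (by omega))
    · exact Fin.ext h
    · exact absurd hij.symm (ginj j i h (by omega))
  · intro i j hij
    have := gcon i (by omega)
    rwa [hij] at this
  · intro i j hi hj
    rw [hi, show (j : ℕ) = m + 1 by omega]
    exact gfl
  · intro i j hi hj
    exact gfar i j hi (by omega) (by omega)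

end IsLinPath

/-! ### From hypergraphs to local systems -/

variable {α : Type*}

theorem IsUniform.exists_eq_triple {H : Hypergraph α} (hunif : H.IsUniform 3) {e : Set α}
    (he : e ∈ H.edgeSet) {a b : α} (ha : a ∈ e) (hb : b ∈ e) (hab : a ≠ b) :
    ∃ c, c ≠ a ∧ c ≠ b ∧ e = {a, b, c} := by
  obtain ⟨x, y, z, hxy, hxz, hyz, rfl⟩ := Set.encard_eq_three.mp (hunif e he)
  have key : ∀ c, c ≠ a → c ≠ b → c ∈ ({x, y, z} : Set α) →
      ∃ c, c ≠ a ∧ c ≠ b ∧ ({x, y, z} : Set α) = {a, b, c} := by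
    intro c hca hcb hc
    refine ⟨c, hca, hcb, ?_⟩
    ext t
    simp only [Set.mem_insert_iff, Set.mem_singleton_iff] at *
    grind
  simp only [Set.mem_insert_iff, Set.mem_singleton_iff] at ha hb
  by_cases hx : x ≠ a ∧ x ≠ b
  · exact key x hx.1 hx.2 (by simp)
  by_cases hy : y ≠ a ∧ y ≠ b
  · exact key y hy.1 hy.2 (by simp)
  exact key z (by grind) (by grind) (by simp)

theorem IsUniform.ne_of_mem {H : Hypergraph α} (hunif : H.IsUniform 3) {a b c : α}
    (h : ({a, b, c} : Set α) ∈ H.edgeSet) : a ≠ b ∧ a ≠ c ∧ b ≠ c := by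
  have h3 := hunif _ h
  have key : ∀ x y : α, ({x, y} : Set α).encard ≠ (3 : ℕ) := fun x y h => by
    have := Set.encard_insert_le {y} x
    rw [h, Set.encard_singleton] at this
    exact absurd this (by decide)
  refine ⟨?_, ?_, ?_⟩
  · rintro rfl; exact key a c (by simpa using h3)
  · rintro rfl; exact key a b (by rwa [Set.pair_comm b a, Set.insert_eq_of_mem (by simp)] at h3)
  · rintro rfl; exact key a b (by simpa using h3)

theorem isLocalSystem_of_subset {H : Hypergraph α} (hunif : H.IsUniform 3)
    (hfree : H.LinearCycleFree) (hK : ¬ H.ContainsCompleteUniform 5 3) {E : Set (Set α)}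
    (hE : E ⊆ H.edgeSet) : IsLocalSystem (fun a b c => ({a, b, c} : Set α) ∈ E) where
  swap {a b c} h := by rwa [Set.insert_comm]
  rot {a b c} h := by rwa [Set.pair_comm c a, Set.insert_comm]
  ne h := (hunif.ne_of_mem (hE h)).1
  no_triangle {a b c x y z} h₁ h₂ h₃ hxy hyz hxz hxc hya hzb := by
    have n₁ := hunif.ne_of_mem (hE h₁)
    have n₂ := hunif.ne_of_mem (hE h₂)
    have n₃ := hunif.ne_of_mem (hE h₃)
    -- A linear triangle is a two-edge linear path closed by the third edge.
    have p : IsLinPath H.edgeSet 2 ({a, b, x} ∪ {b, c, y}) a c := by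
      refine .cons (hE h₁) (by simp) n₁.1 ?_ (.single (hE h₂) (by simp) (by simp) n₂.1)
      ext t
      simp only [Set.mem_insert_iff, Set.mem_singleton_iff, Set.mem_inter_iff]
      grind
    refine p.not_linearCycleFree le_rfl (hE h₃) ?_ hfree
    ext t
    simp only [Set.mem_insert_iff, Set.mem_singleton_iff, Set.mem_inter_iff, Set.mem_union]
    grind
  no_complete {a b c d e} h₁ h₂ h₃ h₄ h₅ h₆ h₇ h₈ h₉ h₀ := by
    have n₁ := hunif.ne_of_mem (hE h₁)
    have n₂ := hunif.ne_of_mem (hE h₉)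
    have n₃ := hunif.ne_of_mem (hE h₅)
    have n₄ := hunif.ne_of_mem (hE h₀)
    have n₅ := hunif.ne_of_mem (hE h₂)
    have hs : ({a, b, c, d, e} : Set α).encard = (5 : ℕ) := by
      rw [Set.encard_insert_of_notMem (by grind), Set.encard_insert_of_notMem (by grind),
        Set.encard_insert_of_notMem (by grind), Set.encard_pair (by grind)]
      norm_num
    let T : α → α → α → Prop := fun a b c => ({a, b, c} : Set α) ∈ E
    have s₁ : ∀ {a b c}, T a b c → T b a c := fun {a b c} (h : _ ∈ E) => by
      change _ ∈ E
      rwa [Set.insert_comm]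
    have s₂ : ∀ {a b c}, T a b c → T b c a := fun {a b c} (h : _ ∈ E) => by
      change _ ∈ E
      rwa [Set.pair_comm c a, Set.insert_comm]
    have key : ∀ x ∈ ({a, b, c, d, e} : Set α), ∀ y ∈ ({a, b, c, d, e} : Set α),
        ∀ z ∈ ({a, b, c, d, e} : Set α), x ≠ y → x ≠ z → y ≠ z → T x y z := by
      change T _ _ _ at h₁ h₂ h₃ h₄ h₅ h₆ h₇ h₈ h₉ h₀
      clear_value T
      intro x hx y hy z hz hxy hxz hyz
      simp only [Set.mem_insert_iff, Set.mem_singleton_iff] at hx hy hz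
      clear hs n₁ n₂ n₃ n₄ n₅
      rcases hx with rfl | rfl | rfl | rfl | rfl <;>
        rcases hy with rfl | rfl | rfl | rfl | rfl <;>
        first
          | exact absurd rfl hxy
          | rcases hz with rfl | rfl | rfl | rfl | rfl <;>
            first
              | exact absurd rfl hxz
              | exact absurd rfl hyz
              | grind
    refine hK ⟨_, hs, ?_, ?_⟩
    · have u₁ := subset_vertexSet_of_mem_edgeSet (hE h₁)
      have u₂ := subset_vertexSet_of_mem_edgeSet (hE h₀)
      intro t ht
      change t ∈ ({a, b, c, d, e} : Set α) at ht
      have ht' : t ∈ ({a, b, c} : Set α) ∪ {c, d, e} := by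
        simp only [Set.mem_insert_iff, Set.mem_singleton_iff, Set.mem_union] at ht ⊢
        tauto
      exact ht'.elim (@u₁ t) (@u₂ t)
    · rintro f ⟨hfs, hf⟩
      obtain ⟨x, y, z, hxy, hxz, hyz, rfl⟩ := Set.encard_eq_three.mp hf
      exact hE (key x (hfs (by simp)) y (hfs (by simp)) z (hfs (by simp)) hxy hxz hyz)

/-! ### Partial colorings and their extension by a block -/

/-- The disjoint colour classes `R` and `S` colour the edges `E` on `R ∪ S`, and any two vertices
of `R ∪ S` at which an edge leaves `R ∪ S` are joined by a linear path inside `R ∪ S`. -/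
structure IsPartialColoring (E : Set (Set α)) (R S : Set α) : Prop where
  disj : ∀ x ∈ R, x ∉ S
  bichromatic : ∀ e ∈ E, ∀ a ∈ e, ∀ b ∈ e, a ∈ R ∪ S → b ∈ R ∪ S → a ≠ b →
    (∃ x ∈ e, x ∈ R) ∧ ∃ y ∈ e, y ∈ S
  connected : ∀ e ∈ E, ∀ f ∈ E, ∀ a b, e ∩ (R ∪ S) = {a} → f ∩ (R ∪ S) = {b} → a ≠ b →
    ∃ n U, U ⊆ R ∪ S ∧ IsLinPath E n U a b

theorem IsPartialColoring.symm {E : Set (Set α)} {R S : Set α} (h : IsPartialColoring E R S) :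
    IsPartialColoring E S R where
  disj x hx hx' := h.disj x hx' hx
  bichromatic e he a ha b hb ha' hb' hab := by
    rw [Set.union_comm] at ha' hb'
    exact (h.bichromatic e he a ha b hb ha' hb' hab).symm
  connected := by
    rw [Set.union_comm]
    exact h.connected

theorem exists_isLinPath_of_joinedIn {H : Hypergraph α} (hunif : H.IsUniform 3)
    {E : Set (Set α)} (hE : E ⊆ H.edgeSet) {B : Set α} {a b : α} (ha : a ∈ B) (hb : b ∈ B)
    (h : JoinedIn (fun a b c => ({a, b, c} : Set α) ∈ E) B a b) (hab : a ≠ b) :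
    ∃ n U, U ⊆ B ∧ IsLinPath E n U a b := by
  rcases h with ⟨c, hc, h⟩ | ⟨m, hm, c, hc, d, hd, h₁, h₂, had, hcd, hcb⟩
  · exact ⟨1, _, by simp [Set.insert_subset_iff, *], .single h (by simp) (by simp) hab⟩
  · have n₁ := hunif.ne_of_mem (hE h₁)
    have n₂ := hunif.ne_of_mem (hE h₂)
    refine ⟨2, {a, c, m} ∪ {m, d, b}, by simp [Set.insert_subset_iff, *],
      .cons h₁ (by simp) n₁.2.1 ?_ (.single h₂ (by simp) (by simp) n₂.2.1)⟩
    ext t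
    simp only [Set.mem_insert_iff, Set.mem_singleton_iff, Set.mem_inter_iff]
    grind

/-- Two linear paths meeting only in their common end are not closed by an edge. -/
theorem false_of_closing_edge {H : Hypergraph α} (hfree : H.LinearCycleFree) {V U W : Set α}
    {n m : ℕ} {q r b o : α} (hU : IsLinPath H.edgeSet n U r q) (hUV : U ⊆ V)
    (hW : IsLinPath H.edgeSet m W q b) (hWV : W ∩ V ⊆ {q})
    (hk : ({r, b, o} : Set α) ∈ H.edgeSet) (hoV : o ∉ V) (hoW : o ∉ W) : False := by
  have hq := hU.right_mem
  have hq' := hW.left_mem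
  have hr := hU.left_mem
  have hb := hW.right_mem
  have h₁ := hU.pos
  have h₂ := hW.pos
  have hWV' : ∀ x ∈ W, x ∈ V → x = q := fun x hx hx' => hWV ⟨hx, hx'⟩
  have hUW : U ∩ W = {q} := by
    ext x
    simp only [Set.mem_inter_iff, Set.mem_singleton_iff]
    exact ⟨fun h => hWV' x h.2 (hUV h.1), by rintro rfl; exact ⟨hq, hq'⟩⟩
  refine (hU.append hW hUW).not_linearCycleFree (by omega) hk ?_ hfree
  ext x
  simp only [Set.mem_insert_iff, Set.mem_singleton_iff, Set.mem_inter_iff, Set.mem_union]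
  constructor
  · rintro ⟨rfl | rfl | rfl, h | h⟩
    · exact Or.inl rfl
    · exact Or.inl rfl
    · exact Or.inr rfl
    · exact Or.inr rfl
    · exact absurd (hUV h) hoV
    · exact absurd h hoW
  · rintro (rfl | rfl)
    · exact ⟨Or.inl rfl, Or.inl hr⟩
    · exact ⟨Or.inr (Or.inl rfl), Or.inr hb⟩

/-- A partial colouring extends along an edge that leaves it at a vertex of the first class. -/
theorem IsPartialColoring.exists_extension_of_mem_left {H : Hypergraph α} (hunif : H.IsUniform 3)
    (hfree : H.LinearCycleFree) (hK : ¬ H.ContainsCompleteUniform 5 3) {R S : Set α}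
    (hRS : IsPartialColoring H.edgeSet R S) {h : Set α} (hh : h ∈ H.edgeSet) {q : α}
    (hq : h ∩ (R ∪ S) = {q}) (hqR : q ∈ R) :
    ∃ R' S', IsPartialColoring H.edgeSet R' S' ∧ R ⊆ R' ∧ S ⊆ S' ∧
      ∃ s ∈ R' ∪ S', s ∉ R ∪ S := by
  set V : Set α := R ∪ S with hV
  have hqV : q ∈ V := Or.inl hqR
  -- Restricting to edges that touch `V` at most in `q` forces the block to meet `V` only in `q`,
  -- since each of its points other than `q` lies on an edge of `E`.
  let E : Set (Set α) := {e | e ∈ H.edgeSet ∧ e ∩ V ⊆ {q}}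
  have hE : E ⊆ H.edgeSet := fun e he => he.1
  have hEV : ∀ e ∈ E, ∀ x ∈ e, x ∈ V → x = q := fun e he x hx hx' => he.2 ⟨hx, hx'⟩
  have hqh : q ∈ h := by
    have : q ∈ h ∩ V := by rw [hq]; rfl
    exact this.1
  have hhE : h ∈ E := ⟨hh, hq.subset⟩
  obtain ⟨s, hsh, hsq⟩ : ∃ s ∈ h, s ≠ q := by
    obtain ⟨x, y, z, hxy, -, -, rfl⟩ := Set.encard_eq_three.mp (hunif h hh)
    by_cases hx : x = q
    · exact ⟨y, by simp, fun e => hxy (hx.trans e.symm)⟩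
    · exact ⟨x, by simp, hx⟩
  obtain ⟨t, -, -, rfl⟩ := hunif.exists_eq_triple hh hqh hsh hsq.symm
  have hT := isLocalSystem_of_subset hunif hfree hK hE
  obtain ⟨B, χ, hqB, hsB, hcol, hconn, hsep⟩ := hT.exists_isBlock hhE
  have hBV : ∀ x ∈ B, x ∈ V → x = q := by
    intro x hx hxV
    by_contra hxq
    rcases hconn x hx q hqB hxq with ⟨c, -, h⟩ | ⟨m, -, c, -, d, -, h, -⟩
    · exact hxq (hEV _ h x (by simp) hxV)
    · exact hxq (hEV _ h x (by simp) hxV)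
  have hpath : ∀ a ∈ B, ∀ b ∈ B, a ≠ b → ∃ n U, U ⊆ B ∧ IsLinPath H.edgeSet n U a b := by
    intro a ha b hb hab
    obtain ⟨n, U, hU, hp⟩ := exists_isLinPath_of_joinedIn hunif hE ha hb (hconn a ha b hb hab) hab
    exact ⟨n, U, hU, hp.mono hE⟩
  -- The block's colors are named so that the class of `q` joins `R`, which contains `q`.
  let R' : Set α := R ∪ {x | x ∈ B ∧ (χ x ↔ χ q)}
  let S' : Set α := S ∪ {x | x ∈ B ∧ ¬ (χ x ↔ χ q)}
  have hV' : ∀ x, x ∈ R' ∪ S' ↔ x ∈ V ∨ x ∈ B := by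
    intro x
    simp only [R', S', V, Set.mem_union, Set.mem_ofPred_eq]
    tauto
  have two : ∀ e : Set α, ∀ u ∈ e, ∀ v ∈ e, u ∈ B → v ∈ B → ¬ (χ u ↔ χ v) →
      (∃ x ∈ e, x ∈ R') ∧ ∃ y ∈ e, y ∈ S' := by
    intro e u hu v hv huB hvB huv
    by_cases hu' : χ u ↔ χ q
    · exact ⟨⟨u, hu, Or.inr ⟨huB, hu'⟩⟩, ⟨v, hv, Or.inr ⟨hvB, by tauto⟩⟩⟩
    · exact ⟨⟨v, hv, Or.inr ⟨hvB, by tauto⟩⟩, ⟨u, hu, Or.inr ⟨huB, hu'⟩⟩⟩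
  have cross : ∀ r b o, r ∈ V → r ≠ q → b ∈ B → b ∉ V → o ∉ V →
      ({r, b, o} : Set α) ∈ H.edgeSet → (∃ x ∈ ({r, b, o} : Set α), x ∈ R') ∧
        ∃ y ∈ ({r, b, o} : Set α), y ∈ S' := by
    intro r b o hrV hrq hbB hbV hoV hk
    have hkn := hunif.ne_of_mem hk
    have hkV : ({r, b, o} : Set α) ∩ V = {r} := by
      ext x
      simp only [Set.mem_insert_iff, Set.mem_singleton_iff, Set.mem_inter_iff]
      constructor
      · rintro ⟨rfl | rfl | rfl, hx⟩
        · rfl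
        · exact absurd hx hbV
        · exact absurd hx hoV
      · rintro rfl
        exact ⟨Or.inl rfl, hrV⟩
    obtain ⟨n, U, hUV, hU⟩ := hRS.connected _ hk _ hh r q hkV hq hrq
    have hqb : q ≠ b := fun e => hbV (e ▸ hqV)
    have hqo : q ≠ o := fun e => hoV (e ▸ hqV)
    by_cases hoB : o ∈ B
    · by_cases hbo : χ b ↔ χ o
      · exfalso
        -- The separating triple is a one-edge path from `q` to one of `b`, `o` that avoids the
        -- other. Together with the path from `r` to `q` it is closed by the edge `r b o`.
        obtain ⟨x, ⟨hx, hxo⟩ | ⟨hx, hxb⟩⟩ := hsep b hbB o hoB hkn.2.2 hqb.symm hqo.symm hbo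
        · exact false_of_closing_edge hfree hU hUV
            (.single (hE hx) (by simp) (by simp) hqb) hx.2 hk hoV
            (by simp [hqo.symm, hkn.2.2.symm, hxo.symm])
        · rw [Set.pair_comm] at hk
          exact false_of_closing_edge hfree hU hUV
            (.single (hE hx) (by simp) (by simp) hqo) hx.2 hk hbV
            (by simp [hqb.symm, hkn.2.2, hxb.symm])
      · exact two _ b (by simp) o (by simp) hbB hoB hbo
    · exfalso
      obtain ⟨m, W, hWB, hW⟩ := hpath q hqB b hbB hqb
      exact false_of_closing_edge hfree hU hUV hW (fun x hx => hBV x (hWB hx.1) hx.2) hk hoV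
        (fun h => hoB (hWB h))
  have joinVB : ∀ {n m U W a b}, IsLinPath H.edgeSet n U a q → U ⊆ V →
      IsLinPath H.edgeSet m W q b → W ⊆ B → U ∩ W = {q} := by
    intro n m U W a b hU hUV hW hWB
    ext x
    constructor
    · rintro ⟨hx, hx'⟩
      exact hBV x (hWB hx') (hUV hx)
    · rintro rfl
      exact ⟨hU.right_mem, hW.left_mem⟩
  have subV : ∀ {U}, U ⊆ V → U ⊆ R' ∪ S' := fun hU x hx => (hV' x).mpr (Or.inl (hU hx))
  have subB : ∀ {U}, U ⊆ B → U ⊆ R' ∪ S' := fun hU x hx => (hV' x).mpr (Or.inr (hU hx))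
  have active : ∀ e a, e ∩ (R' ∪ S') = {a} → a ∈ V → e ∩ V = {a} := by
    intro e a he ha
    have ha' : a ∈ e ∩ (R' ∪ S') := by rw [he]; rfl
    refine Set.Subset.antisymm ?_ ?_
    · rw [← he]
      exact Set.inter_subset_inter_right _ (subV subset_rfl)
    · rintro x rfl
      exact ⟨ha'.1, ha⟩
  refine ⟨R', S', ⟨?_, ?_, ?_⟩, Set.subset_union_left, Set.subset_union_left, s,
    (hV' s).mpr (Or.inr hsB), fun hs => hsq (hBV s hsB hs)⟩
  · rintro x (hx | ⟨hx, hx'⟩) (hy | ⟨hy, hy'⟩)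
    · exact hRS.disj x hx hy
    · exact hy' (by rw [hBV x hy (Or.inl hx)])
    · exact hRS.disj q hqR (hBV x hx (Or.inr hy) ▸ hy)
    · exact hy' hx'
  · intro e he a ha b hb haV hbV hab
    -- An edge with two points in `V` is handled by the old coloring, one through a single point `r
    -- ≠ q` of `V` by `cross`, and any other lies in `E` and is handled by the block.
    by_cases h2 : ∃ x ∈ e, ∃ y ∈ e, x ∈ V ∧ y ∈ V ∧ x ≠ y
    · obtain ⟨x, hx, y, hy, hxV, hyV, hxy⟩ := h2
      obtain ⟨⟨u, hu, hu'⟩, ⟨v, hv, hv'⟩⟩ := hRS.bichromatic e he x hx y hy hxV hyV hxy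
      exact ⟨⟨u, hu, Or.inl hu'⟩, ⟨v, hv, Or.inl hv'⟩⟩
    have one : ∀ x ∈ e, ∀ y ∈ e, x ∈ V → y ∈ V → x = y := by
      intro x hx y hy hxV hyV
      by_contra hxy
      exact h2 ⟨x, hx, y, hy, hxV, hyV, hxy⟩
    rw [hV'] at haV hbV
    by_cases hr : ∃ r ∈ e, r ∈ V ∧ r ≠ q
    · obtain ⟨r, hr, hrV, hrq⟩ := hr
      obtain ⟨b, hb, hbB, hbr⟩ : ∃ b ∈ e, b ∈ B ∧ b ≠ r := by
        by_cases har : a = r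
        · refine ⟨b, hb, hbV.resolve_left fun h => hab (one a ha b hb (har ▸ hrV) h), ?_⟩
          exact fun h => hab (har.trans h.symm)
        · exact ⟨a, ha, haV.resolve_left fun h => har (one a ha r hr h hrV), har⟩
      obtain ⟨o, hor, hob, rfl⟩ := hunif.exists_eq_triple he hr hb hbr.symm
      exact cross r b o hrV hrq hbB (fun h => hbr (one b hb r hr h hrV))
        (fun h => hor (one o (by simp) r hr h hrV)) he
    · have hrq : ∀ r ∈ e, r ∈ V → r = q := by
        intro r hr' hrV
        by_contra hrq
        exact hr ⟨r, hr', hrV, hrq⟩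
      have heE : e ∈ E := ⟨he, fun x hx => hrq x hx.1 hx.2⟩
      have haB : a ∈ B := haV.elim (fun h => hrq a ha h ▸ hqB) id
      have hbB : b ∈ B := hbV.elim (fun h => hrq b hb h ▸ hqB) id
      obtain ⟨c, -, -, rfl⟩ := hunif.exists_eq_triple he ha hb hab
      by_cases hχ : χ a ↔ χ b
      · obtain ⟨hcB, hc⟩ := hcol a b c heE haB hbB hχ
        exact two _ c (by simp) a (by simp) hcB haB hc
      · exact two _ a ha b hb haB hbB hχ
  · intro e he f hf a b hea hfb hab
    have haV : a ∈ e ∩ (R' ∪ S') := by rw [hea]; rfl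
    have hbV : b ∈ f ∩ (R' ∪ S') := by rw [hfb]; rfl
    have haV := (hV' a).mp haV.2
    have hbV := (hV' b).mp hbV.2
    -- A vertex of `V` that is still active was active before, and `q` was active because of `h`;
    -- paths in `V` and in `B` can therefore be joined at `q`.
    by_cases ha : a ∈ V
    · have hea' := active e a hea ha
      by_cases hb : b ∈ V
      · obtain ⟨n, U, hU, hp⟩ := hRS.connected e he f hf a b hea' (active f b hfb hb) hab
        exact ⟨n, U, subV hU, hp⟩
      · have hbB := hbV.resolve_left hb
        obtain ⟨m, W, hW, hp⟩ := hpath q hqB b hbB (fun h => hb (h ▸ hqV))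
        by_cases haq : a = q
        · subst haq
          exact ⟨m, W, subB hW, hp⟩
        · obtain ⟨n, U, hU, hp'⟩ := hRS.connected e he _ hh a q hea' hq haq
          exact ⟨n + m, U ∪ W, Set.union_subset (subV hU) (subB hW),
            hp'.append hp (joinVB hp' hU hp hW)⟩
    · have haB := haV.resolve_left ha
      by_cases hb : b ∈ V
      · obtain ⟨m, W, hW, hp⟩ := hpath a haB q hqB (fun h => ha (h ▸ hqV))
        by_cases hbq : b = q
        · subst hbq
          exact ⟨m, W, subB hW, hp⟩
        · obtain ⟨n, U, hU, hp'⟩ :=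
            hRS.connected _ hh f hf q b hq (active f b hfb hb) (Ne.symm hbq)
          refine ⟨m + n, W ∪ U, Set.union_subset (subB hW) (subV hU), hp.append hp' ?_⟩
          ext x
          constructor
          · rintro ⟨hx, hx'⟩
            exact hBV x (hW hx) (hU hx')
          · rintro rfl
            exact ⟨hp.right_mem, hp'.left_mem⟩
      · obtain ⟨m, W, hW, hp⟩ := hpath a haB b (hbV.resolve_left hb) hab
        exact ⟨m, W, subB hW, hp⟩

theorem IsPartialColoring.exists_extension {H : Hypergraph α} (hunif : H.IsUniform 3)
    (hfree : H.LinearCycleFree) (hK : ¬ H.ContainsCompleteUniform 5 3) {R S : Set α}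
    (hRS : IsPartialColoring H.edgeSet R S) {h : Set α} (hh : h ∈ H.edgeSet) {q : α}
    (hq : h ∩ (R ∪ S) = {q}) :
    ∃ R' S', IsPartialColoring H.edgeSet R' S' ∧ R ⊆ R' ∧ S ⊆ S' ∧
      ∃ s ∈ R' ∪ S', s ∉ R ∪ S := by
  have hqV : q ∈ h ∩ (R ∪ S) := by rw [hq]; rfl
  rcases hqV.2 with hqR | hqS
  · exact hRS.exists_extension_of_mem_left hunif hfree hK hh hq hqR
  · rw [Set.union_comm] at hq
    obtain ⟨S', R', h', hS, hR, s, hs, hs'⟩ :=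
      hRS.symm.exists_extension_of_mem_left hunif hfree hK hh hq hqS
    exact ⟨R', S', h'.symm, hR, hS, s, by rwa [Set.union_comm], by rwa [Set.union_comm]⟩

/-! ### Maximal partial colorings are total -/

/-- Unions of chains are admissible because each condition concerns at most two vertices of the
union, and these lie in a common member of the chain. An edge meeting the union in one point of that
member meets the member in the same single point. -/
theorem exists_maximal_isPartialColoring (E : Set (Set α)) :
    ∃ P : Set α × Set α,
      Maximal (· ∈ {P : Set α × Set α | IsPartialColoring E P.1 P.2}) P := by
  refine zorn_le₀ _ fun c hc hchain => ?_
  have memU : ∀ {x}, x ∈ (⋃ P ∈ c, P.1) ∪ (⋃ P ∈ c, P.2) → ∃ P ∈ c, x ∈ P.1 ∪ P.2 := by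
    intro x hx
    simp only [Set.mem_union, Set.mem_iUnion, exists_prop] at hx
    rcases hx with ⟨P, hP, hx⟩ | ⟨P, hP, hx⟩
    · exact ⟨P, hP, Or.inl hx⟩
    · exact ⟨P, hP, Or.inr hx⟩
  have sub1 : ∀ P ∈ c, P.1 ⊆ ⋃ P ∈ c, P.1 := fun P hP =>
    Set.subset_biUnion_of_mem (u := Prod.fst) hP
  have sub2 : ∀ P ∈ c, P.2 ⊆ ⋃ P ∈ c, P.2 := fun P hP =>
    Set.subset_biUnion_of_mem (u := Prod.snd) hP
  have sub : ∀ P ∈ c, P.1 ∪ P.2 ⊆ (⋃ P ∈ c, P.1) ∪ ⋃ P ∈ c, P.2 := fun P hP =>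
    Set.union_subset_union (sub1 P hP) (sub2 P hP)
  have common : ∀ P ∈ c, ∀ Q ∈ c, ∃ M ∈ c, P ≤ M ∧ Q ≤ M := by
    intro P hP Q hQ
    rcases hchain.total hP hQ with h | h
    · exact ⟨Q, hQ, h, le_rfl⟩
    · exact ⟨P, hP, le_rfl, h⟩
  have mem2 : ∀ {x y}, x ∈ (⋃ P ∈ c, P.1) ∪ (⋃ P ∈ c, P.2) →
      y ∈ (⋃ P ∈ c, P.1) ∪ (⋃ P ∈ c, P.2) → ∃ M ∈ c, x ∈ M.1 ∪ M.2 ∧ y ∈ M.1 ∪ M.2 := by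
    intro x y hx hy
    obtain ⟨P, hP, hx⟩ := memU hx
    obtain ⟨Q, hQ, hy⟩ := memU hy
    obtain ⟨M, hM, hPM, hQM⟩ := common P hP Q hQ
    exact ⟨M, hM, Set.union_subset_union hPM.1 hPM.2 hx, Set.union_subset_union hQM.1 hQM.2 hy⟩
  refine ⟨(⋃ P ∈ c, P.1, ⋃ P ∈ c, P.2), ⟨?_, ?_, ?_⟩, fun P hP => ⟨sub1 P hP, sub2 P hP⟩⟩
  · intro x hx hx'
    simp only [Set.mem_iUnion, exists_prop] at hx hx'
    obtain ⟨P, hP, hx⟩ := hx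
    obtain ⟨Q, hQ, hx'⟩ := hx'
    obtain ⟨M, hM, hPM, hQM⟩ := common P hP Q hQ
    exact (hc hM).disj x (hPM.1 hx) (hQM.2 hx')
  · intro e he a ha b hb haV hbV hab
    obtain ⟨M, hM, haM, hbM⟩ := mem2 haV hbV
    obtain ⟨⟨x, hx, hx'⟩, ⟨y, hy, hy'⟩⟩ := (hc hM).bichromatic e he a ha b hb haM hbM hab
    exact ⟨⟨x, hx, sub1 M hM hx'⟩, ⟨y, hy, sub2 M hM hy'⟩⟩
  · intro e he f hf a b hea hfb hab
    dsimp only at hea hfb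
    have haV : a ∈ e ∩ ((⋃ P ∈ c, P.1) ∪ ⋃ P ∈ c, P.2) := by rw [hea]; rfl
    have hbV : b ∈ f ∩ ((⋃ P ∈ c, P.1) ∪ ⋃ P ∈ c, P.2) := by rw [hfb]; rfl
    obtain ⟨M, hM, haM, hbM⟩ := mem2 haV.2 hbV.2
    have restrict : ∀ g x, g ∩ ((⋃ P ∈ c, P.1) ∪ ⋃ P ∈ c, P.2) = {x} → x ∈ g → x ∈ M.1 ∪ M.2 →
        g ∩ (M.1 ∪ M.2) = {x} := by
      intro g x hg hxg hx
      refine Set.Subset.antisymm ?_ (Set.singleton_subset_iff.mpr ⟨hxg, hx⟩)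
      rw [← hg]
      exact Set.inter_subset_inter_right _ (sub M hM)
    obtain ⟨n, U, hU, hp⟩ := (hc hM).connected e he f hf a b (restrict e a hea haV.1 haM)
      (restrict f b hfb hbV.1 hbM) hab
    exact ⟨n, U, hU.trans (sub M hM), hp⟩

theorem exists_total_isPartialColoring {H : Hypergraph α} (hunif : H.IsUniform 3)
    (hfree : H.LinearCycleFree) (hK : ¬ H.ContainsCompleteUniform 5 3) :
    ∃ R S, IsPartialColoring H.edgeSet R S ∧ R ∪ S = Set.univ := by
  obtain ⟨⟨R, S⟩, hP, hmax⟩ := exists_maximal_isPartialColoring H.edgeSet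
  change IsPartialColoring H.edgeSet R S at hP
  refine ⟨R, S, hP, ?_⟩
  have stuck : ∀ R' S', IsPartialColoring H.edgeSet R' S' → R ⊆ R' → S ⊆ S' →
      ∀ s ∈ R' ∪ S', s ∈ R ∪ S := by
    intro R' S' h hR hS s hs
    have := @hmax (R', S') h ⟨hR, hS⟩
    exact Set.union_subset_union this.1 this.2 hs
  have inactive : ∀ e ∈ H.edgeSet, ∀ q, e ∩ (R ∪ S) ≠ {q} := by
    intro e he q hq
    obtain ⟨R', S', h, hR, hS, s, hs, hs'⟩ := hP.exists_extension hunif hfree hK he hq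
    exact hs' (stuck R' S' h hR hS s hs)
  have two : ∀ e ∈ H.edgeSet, ∀ a ∈ e, a ∈ R ∪ S → ∃ b ∈ e, b ∈ R ∪ S ∧ a ≠ b := by
    intro e he a ha haV
    by_contra! hn
    refine inactive e he a (Set.Subset.antisymm ?_ (Set.singleton_subset_iff.mpr ⟨ha, haV⟩))
    exact fun x hx => (hn x hx.1 hx.2).symm
  by_contra hne
  obtain ⟨v, hv⟩ := (Set.ne_univ_iff_exists_notMem _).mp hne
  have hins : insert v R ∪ S = insert v (R ∪ S) := Set.insert_union
  -- Every edge touching `R ∪ S` has two vertices there, so adding `v` creates no new color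
  -- condition, and `v` is the only vertex that can become active.
  refine hv (stuck (insert v R) S ⟨?_, ?_, ?_⟩ (Set.subset_insert _ _) subset_rfl v (by simp))
  · rintro x (rfl | hx) hxS
    · exact hv (Or.inr hxS)
    · exact hP.disj x hx hxS
  · intro e he a ha b hb haV hbV hab
    rw [hins] at haV hbV
    obtain ⟨c, hc, hcV⟩ : ∃ c ∈ e, c ∈ R ∪ S := by
      rcases haV with rfl | haV
      · exact ⟨b, hb, hbV.resolve_left fun h => hab h.symm⟩
      · exact ⟨a, ha, haV⟩
    obtain ⟨d, hd, hdV, hcd⟩ := two e he c hc hcV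
    obtain ⟨⟨x, hx, hx'⟩, hy⟩ := hP.bichromatic e he c hc d hd hcV hdV hcd
    exact ⟨⟨x, hx, Or.inr hx'⟩, hy⟩
  · intro e he f hf a b hea hfb hab
    have key : ∀ g ∈ H.edgeSet, ∀ x, g ∩ (insert v R ∪ S) = {x} → x = v := by
      intro g hg x hgx
      rw [hins] at hgx
      have hx : x ∈ g ∩ insert v (R ∪ S) := by rw [hgx]; rfl
      refine hx.2.resolve_right fun hxV => ?_
      obtain ⟨y, hy, hyV, hxy⟩ := two g hg x hx.1 hxV
      have : y ∈ g ∩ insert v (R ∪ S) := ⟨hy, Or.inr hyV⟩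
      rw [hgx] at this
      exact hxy this.symm
    exact absurd ((key e he a hea).trans (key f hf b hfb).symm) hab

end Hypergraph

theorem mainTheorem1 {α : Type*} (H : Hypergraph α) (hunif : H.IsUniform 3)
    (hfree : H.LinearCycleFree) (hK : ¬ H.ContainsCompleteUniform 5 3) :
    H.IsColorable 2 := by
  classical
  obtain ⟨R, S, hRS, huniv⟩ := Hypergraph.exists_total_isPartialColoring hunif hfree hK
  refine ⟨fun x => if (x : α) ∈ R then 0 else 1, fun e he => ?_⟩
  rintro ⟨κ, hκ⟩
  obtain ⟨a, b, c, hab, -, -, rfl⟩ := Set.encard_eq_three.mp (hunif e he)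
  obtain ⟨⟨x, hx, hxR⟩, ⟨y, hy, hyS⟩⟩ := hRS.bichromatic _ he a (by simp) b (by simp)
    (huniv ▸ Set.mem_univ a) (huniv ▸ Set.mem_univ b) hab
  have hsub := Hypergraph.subset_vertexSet_of_mem_edgeSet he
  have h₁ := hκ ⟨x, hsub hx⟩ hx
  have h₂ := hκ ⟨y, hsub hy⟩ hy
  have hyR : y ∉ R := fun h => hRS.disj y h hyS
  simp only [hxR, hyR, if_true, if_false] at h₁ h₂
  exact absurd (h₁.trans h₂.symm) (by decide)
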